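/- **Language.** Fix a set $\mathbf V$ of variables, which is infinite, and sets $\mathbf N$ of names, $\mathbf I$ of agents and $\mathbf P$ of predicate symbols, each with an arity $n\ge 0$ (these three sets are arbitrary). Terms and formulas of public announcement logic with assignments ($\mathbf{PALAS}$) are $$t ::= x\mid a,\qquad \varphi ::= t\approx t\mid P\vec t\mid(\varphi\land\varphi)\mid\neg\varphi\mid \mathsf K_i\varphi\mid[x:=t]\varphi\mid[!\varphi]\varphi$$ with $x\in\mathbf V$, $a\in\mathbf N$, $P\in\mathbf P$, $i\in\mathbf I$. The formulas $t\approx t'$ and $P\vec t$ are atomic; $\to,\leftrightarrow,\top$ are the usual abbreviations, $t\not\approx t'$ is $\neg(t\approx t')$, and $\langle x:=t\rangle\varphi$ is $\neg[x:=t]\neg\varphi$. The operator $[x:=t]$ binds $x$ in its scope (but not in $t$); no other operator binds variables. $\varphi[y/x]$ is the result of replacing all free occurrences of $x$ in $\varphi$ by $y$; it is admissible if all these new occurrences of $y$ are free. **Semantics.** A model $\mathcal M=\langle W,D,R,\rho,\eta\rangle$ has non-empty sets $W$ (worlds) and $D$ (domain), a relation $R_i\subseteq W\times W$ for each agent $i$,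 a set $\rho(P,w)\subseteq D^n$ for each $n$-ary $P$ and each $w\in W$, and an element $\eta(a,w)\in D$ for each name $a$ and each $w\in W$. It is epistemic if every $R_i$ is an equivalence relation. For $\sigma:\mathbf V\to D$ let $\sigma_w(x)=\sigma(x)$ and $\sigma_w(a)=\eta(a,w)$. Put - $\mathcal M,w,\sigma\vDash t\approx t'$ iff $\sigma_w(t)=\sigma_w(t')$; - $\mathcal M,w,\sigma\vDash P(t_1\cdots t_n)$ iff $(\sigma_w(t_1),\dots,\sigma_w(t_n))\in\rho(P,w)$; - $\neg$ and $\land$ as usual; - $\mathcal M,w,\sigma\vDash\mathsf K_i\varphi$ iff $\mathcal M,v,\sigma\vDash\varphi$ for all $v$ with $wR_iv$; - $\mathcal M,w,\sigma\vDash[x:=t]\varphi$ iff $\mathcal M,w,\sigma[x\mapsto\sigma_w(t)]\vDash\varphi$; - $\mathcal M,w,\sigma\vDash[!\psi]\varphi$ iff $\mathcal M,w,\sigma\vDash\psi$ implies $\mathcal M|^\sigma_\psi,w,\sigma\vDash\varphi$, where $\mathcal M|^\sigma_\psi$ is the restriction of $\mathcal M$ to the set of worlds $\{v\mid\mathcal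 M,v,\sigma\vDash\psi\}$, with the same domain $D$. **The system $\mathsf{SPALAS5}$.** The axioms, for all $\mathbf{PALAS}$-formulas $\varphi,\psi,\chi$, terms $t,t',t''$, variables $x,y,z$ and agents $i$, are all instances of propositional tautologies and the following schemata. SBELAS: - $\mathsf K_i(\varphi\to\psi)\to(\mathsf K_i\varphi\to\mathsf K_i\psi)$; - $t\approx t$; $\ t\approx t'\leftrightarrow t'\approx t$; $\ t\approx t'\land t'\approx t''\to t\approx t''$; - $t\approx t'\to([x:=t]\varphi\leftrightarrow[x:=t']\varphi)$; - $\bigwedge_k t_k\approx t'_k\to(P\vec t\leftrightarrow P\vec t')$; - $x\approx y\to\mathsf K_i\,x\approx y$; $\ x\not\approx y\to\mathsf K_i\,x\not\approx y$; - $[x:=t](\varphi\to\psi)\to([x:=t]\varphi\to[x:=t]\psi)$; $\ \langle x:=t\rangle\varphi\to[x:=t]\varphi$; $\ \langle x:=t\rangle\top$; - $[x:=t]\,x\approx t$; - $\varphi[y/x]\to[x:=y]\varphi$, if $\varphi[y/x]$ is admissible. S5: - $\mathsf K_i\varphi\to\varphi$; $\ \mathsf K_i\varphi\to\mathsf K_i\mathsf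 K_i\varphi$; $\ \neg\mathsf K_i\varphi\to\mathsf K_i\neg\mathsf K_i\varphi$. Reduction axioms: - $[!\psi]p\leftrightarrow(\psi\to p)$, for atomic $p$; - $[!\psi]\neg\varphi\leftrightarrow(\psi\to\neg[!\psi]\varphi)$; - $[!\psi](\varphi\land\chi)\leftrightarrow([!\psi]\varphi\land[!\psi]\chi)$; - $[!\psi]\mathsf K_i\varphi\leftrightarrow(\psi\to\mathsf K_i[!\psi]\varphi)$; - $[!\psi][!\chi]\varphi\leftrightarrow[!(\psi\land[!\psi]\chi)]\varphi$; - (AASSI) $[!\psi][x:=t]\varphi\leftrightarrow[z:=x][x:=t][!\psi[z/x]]\varphi$, if $z$ does not occur in $[!\psi][x:=t]\varphi$. The rules are: from $\varphi$ infer $\mathsf K_i\varphi$; from $\varphi$ and $\varphi\to\psi$ infer $\psi$; from $\varphi\to\psi$ infer $\varphi\to[x:=t]\psi$, if $x$ is not free in $\varphi$. **Theorem.** $\mathsf{SPALAS5}$ is complete over epistemic models: for every $\mathbf{PALAS}$-formula $\varphi$, if $\mathcal M,w,\sigma\vDash\varphi$ for every epistemic model $\mathcal M$, every world $w$ of $\mathcal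 M$ and every $\sigma:\mathbf V\to D$, then $\varphi$ is derivable in $\mathsf{SPALAS5}$. -/

import Mathlib

universe u

namespace PALAS

/-- Terms: variables `x ∈ V` and names `a ∈ N`. -/
inductive Term (V N : Type u) : Type u
  | var : V → Term V N
  | name : N → Term V N

/-- Formulas of public announcement logic with assignments.
`P` is the set of predicate symbols, `ar p` is the arity of `p`. -/
inductive Formula (V N I : Type u) {P : Type u} (ar : P → ℕ) : Type u
  /-- `t ≈ t'` -/
  | eq : Term V N → Term V N → Formula V N I ar
  /-- `P t₁ … tₙ` -/
  | pred : (p : P) → (Fin (ar p) → Term V N) → Formula V N I ar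
  | and : Formula V N I ar → Formula V N I ar → Formula V N I ar
  | neg : Formula V N I ar → Formula V N I ar
  /-- `K_i φ` -/
  | know : I → Formula V N I ar → Formula V N I ar
  /-- `[x := t] φ` -/
  | assign : V → Term V N → Formula V N I ar → Formula V N I ar
  /-- `[!ψ] φ` -/
  | ann : Formula V N I ar → Formula V N I ar → Formula V N I ar

section Language_

variable {V N I P : Type u} {ar : P → ℕ}

namespace Formula

/-- `φ → ψ` -/
def imp (φ ψ : Formula V N I ar) : Formula V N I ar := neg (and φ (neg ψ))

/-- `φ ↔ ψ` -/
def iff (φ ψ : Formula V N I ar) : Formula V N I ar := and (imp φ ψ) (imp ψ φ)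

/-- `⟨x := t⟩ φ` -/
def dassign (x : V) (t : Term V N) (φ : Formula V N I ar) : Formula V N I ar :=
  neg (assign x t (neg φ))

/-- The constant `⊤`, written as the tautology `χ → χ`. -/
def verum (χ : Formula V N I ar) : Formula V N I ar := imp χ χ

/-- The conjunction of a list of formulas; `χ` only serves to write `⊤`. -/
def conj (χ : Formula V N I ar) (l : List (Formula V N I ar)) : Formula V N I ar :=
  l.foldr and (verum χ)

/-- `t ≈ t'` and `P t₁ … tₙ` are the atomic formulas. -/
inductive IsAtomic : Formula V N I ar → Prop
  | eq (t t' : Term V N) : IsAtomic (Formula.eq t t')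
  | pred (p : P) (ts : Fin (ar p) → Term V N) : IsAtomic (Formula.pred p ts)

/-- An instance of a propositional tautology: a formula that is true under every assignment
of truth values to all formulas that respects negation and conjunction. -/
def IsTautology (φ : Formula V N I ar) : Prop :=
  ∀ v : Formula V N I ar → Prop,
    (∀ α, v (neg α) ↔ ¬ v α) → (∀ α β, v (and α β) ↔ (v α ∧ v β)) → v φ

end Formula

variable [DecidableEq V]

/-- The variables of a term. -/
def Term.vars : Term V N → Finset V
  | .var x => {x}
  | .name _ => ∅

/-- `t[y/x]` -/
def Term.subst (y x : V) : Term V N → Term V N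
  | .var z => if z = x then .var y else .var z
  | .name a => .name a

namespace Formula

/-- All variables that occur in a formula, whether free, bound or in a binder. -/
def vars : Formula V N I ar → Finset V
  | eq t t' => t.vars ∪ t'.vars
  | pred _ ts => Finset.univ.biUnion fun k => (ts k).vars
  | and φ ψ => φ.vars ∪ ψ.vars
  | neg φ => φ.vars
  | know _ φ => φ.vars
  | assign x t φ => insert x (t.vars ∪ φ.vars)
  | ann ψ φ => ψ.vars ∪ φ.vars

/-- The free variables of a formula; `[x := t]` binds `x` in its scope. -/
def fv : Formula V N I ar → Finset V
  | eq t t' => t.vars ∪ t'.vars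
  | pred _ ts => Finset.univ.biUnion fun k => (ts k).vars
  | and φ ψ => φ.fv ∪ ψ.fv
  | neg φ => φ.fv
  | know _ φ => φ.fv
  | assign x t φ => (φ.fv \ {x}) ∪ t.vars
  | ann ψ φ => ψ.fv ∪ φ.fv

/-- `φ[y/x]`: every free occurrence of `x` in `φ` is replaced by `y`. -/
def subst (y x : V) : Formula V N I ar → Formula V N I ar
  | eq t t' => eq (t.subst y x) (t'.subst y x)
  | pred p ts => pred p fun k => (ts k).subst y x
  | and φ ψ => and (subst y x φ) (subst y x ψ)
  | neg φ => neg (subst y x φ)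
  | know i φ => know i (subst y x φ)
  | assign z t φ => assign z (t.subst y x) (if z = x then φ else subst y x φ)
  | ann ψ φ => ann (subst y x ψ) (subst y x φ)

/-- `φ[y/x]` is admissible: no occurrence of `y` that replaces a free occurrence of `x`
gets bound. -/
def Admissible (y x : V) : Formula V N I ar → Prop
  | eq _ _ => True
  | pred _ _ => True
  | and φ ψ => Admissible y x φ ∧ Admissible y x ψ
  | neg φ => Admissible y x φ
  | know _ φ => Admissible y x φ
  | assign z _ φ => z = x ∨ (Admissible y x φ ∧ (z = y → x ∉ φ.fv))
  | ann ψ φ => Admissible y x ψ ∧ Admissible y x φ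

end Formula

open Formula Term

/-- The axioms of SBELAS. -/
inductive SBELASAxiom : Formula V N I ar → Prop
  | taut (φ) : IsTautology φ → SBELASAxiom φ
  | distK (i : I) (φ ψ) :
      SBELASAxiom (imp (know i (imp φ ψ)) (imp (know i φ) (know i ψ)))
  | id (t) : SBELASAxiom (eq t t)
  | sym (t t') : SBELASAxiom (iff (eq t t') (eq t' t))
  | trans (t t' t'') : SBELASAxiom (imp (and (eq t t') (eq t' t'')) (eq t t''))
  | subAs (t t') (x : V) (φ) :
      SBELASAxiom (imp (eq t t') (iff (assign x t φ) (assign x t' φ)))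
  | subP (p : P) (ts ts' : Fin (ar p) → Term V N) :
      SBELASAxiom (imp (conj (pred p ts) (List.ofFn fun k => eq (ts k) (ts' k)))
        (iff (pred p ts) (pred p ts')))
  | rigidP (i : I) (x y : V) :
      SBELASAxiom (imp (eq (var x) (var y)) (know i (eq (var x) (var y))))
  | rigidN (i : I) (x y : V) :
      SBELASAxiom (imp (neg (eq (var x) (var y))) (know i (neg (eq (var x) (var y)))))
  | kAs (x : V) (t) (φ ψ) :
      SBELASAxiom (imp (assign x t (imp φ ψ)) (imp (assign x t φ) (assign x t ψ)))
  | detAs (x : V) (t) (φ) : SBELASAxiom (imp (dassign x t φ) (assign x t φ))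
  | dAs (x : V) (t) (χ) : SBELASAxiom (dassign x t (verum χ))
  | efAs (x : V) (t) : SBELASAxiom (assign x t (eq (var x) t))
  | sub2As (x y : V) (φ) : Admissible y x φ →
      SBELASAxiom (imp (subst y x φ) (assign x (var y) φ))

/-- The S5 axioms for the knowledge operators. -/
inductive S5Axiom : Formula V N I ar → Prop
  | t (i : I) (φ) : S5Axiom (imp (know i φ) φ)
  | four (i : I) (φ) : S5Axiom (imp (know i φ) (know i (know i φ)))
  | five (i : I) (φ) : S5Axiom (imp (neg (know i φ)) (know i (neg (know i φ))))

/-- The reduction axioms for announcements. -/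
inductive AnnouncementAxiom : Formula V N I ar → Prop
  | aAtom (ψ p) : IsAtomic p → AnnouncementAxiom (iff (ann ψ p) (imp ψ p))
  | aNeg (ψ φ) : AnnouncementAxiom (iff (ann ψ (neg φ)) (imp ψ (neg (ann ψ φ))))
  | aCon (ψ φ χ) : AnnouncementAxiom (iff (ann ψ (and φ χ)) (and (ann ψ φ) (ann ψ χ)))
  | aK (i : I) (ψ φ) : AnnouncementAxiom (iff (ann ψ (know i φ)) (imp ψ (know i (ann ψ φ))))
  | aCom (ψ χ φ) : AnnouncementAxiom (iff (ann ψ (ann χ φ)) (ann (and ψ (ann ψ χ)) φ))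
  | aAssi (ψ) (x : V) (t) (φ) (z : V) : z ∉ (ann ψ (assign x t φ)).vars →
      AnnouncementAxiom (iff (ann ψ (assign x t φ))
        (assign z (var x) (assign x t (ann (subst z x ψ) φ))))

/-- `SPALAS5 φ`: the formula `φ` is derivable in the system SPALAS5, which has the axioms of
SBELAS, the S5 axioms and the reduction axioms (all for arbitrary formulas of the language with
announcements), and the three rules of SBELAS. -/
inductive SPALAS5 : Formula V N I ar → Prop
  | sbelas {φ} : SBELASAxiom φ → SPALAS5 φ
  | s5 {φ} : S5Axiom φ → SPALAS5 φ
  | announcement {φ} : AnnouncementAxiom φ → SPALAS5 φ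
  | necK (i : I) {φ} : SPALAS5 φ → SPALAS5 (know i φ)
  | mp {φ ψ} : SPALAS5 φ → SPALAS5 (imp φ ψ) → SPALAS5 ψ
  | necAs (x : V) (t) {φ ψ} : x ∉ φ.fv → SPALAS5 (imp φ ψ) → SPALAS5 (imp φ (assign x t ψ))

end Language_

section Semantics

/-- Constant domain first-order Kripke models. -/
structure Model (N I : Type u) {P : Type u} (ar : P → ℕ) : Type (u + 1) where
  /-- possible worlds -/
  W : Type u
  /-- the domain of objects -/
  D : Type u
  nonempty_W : Nonempty W
  nonempty_D : Nonempty D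
  /-- the accessibility relations -/
  R : I → W → W → Prop
  /-- the interpretation of the predicates at each world -/
  ρ : (p : P) → W → Set (Fin (ar p) → D)
  /-- the interpretation of the names at each world -/
  η : N → W → D

variable {V N I P : Type u} {ar : P → ℕ}

/-- An epistemic model: all accessibility relations are equivalence relations. -/
def Model.IsEpistemic (M : Model N I ar) : Prop := ∀ i, Equivalence (M.R i)

/-- The submodel of `M` with a nonempty set `S` of worlds. -/
abbrev Model.restrict (M : Model N I ar) (S : Set M.W) (hS : S.Nonempty) : Model N I ar where
  W := S
  D := M.D
  nonempty_W := hS.to_subtype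
  nonempty_D := M.nonempty_D
  R i v v' := M.R i v.1 v'.1
  ρ p v := M.ρ p v.1
  η a v := M.η a v.1

/-- The value of a term at a world under an assignment of the variables. -/
def Term.eval (M : Model N I ar) (w : M.W) (σ : V → M.D) : Term V N → M.D
  | .var x => σ x
  | .name a => M.η a w

/-- Satisfaction `M, w, σ ⊨ φ`. For `[!ψ] φ`: if `M, w, σ ⊨ ψ`, then `φ` holds at `w` in the
submodel of the worlds `v` with `M, v, σ ⊨ ψ`. -/
def Sat [DecidableEq V] : Formula V N I ar → (M : Model N I ar) → M.W → (V → M.D) → Prop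
  | .eq t t', M, w, σ => t.eval M w σ = t'.eval M w σ
  | .pred p ts, M, w, σ => (fun k => (ts k).eval M w σ) ∈ M.ρ p w
  | .and φ ψ, M, w, σ => Sat φ M w σ ∧ Sat ψ M w σ
  | .neg φ, M, w, σ => ¬ Sat φ M w σ
  | .know i φ, M, w, σ => ∀ v, M.R i w v → Sat φ M v σ
  | .assign x t φ, M, w, σ => Sat φ M w (Function.update σ x (t.eval M w σ))
  | .ann ψ φ, M, w, σ =>
      ∀ h : Sat ψ M w σ, Sat φ (M.restrict {v | Sat ψ M v σ} ⟨w, h⟩) ⟨w, h⟩ σ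

/-- `φ` is valid over epistemic models: true in all pointed epistemic models. -/
def EpistemicValid [DecidableEq V] (φ : Formula V N I ar) : Prop :=
  ∀ M : Model N I ar, M.IsEpistemic → ∀ (w : M.W) (σ : V → M.D), Sat φ M w σ

end Semantics

end PALAS

/-! A canonical model is built for the full language. Announcements are treated inside the truth
lemma `satOn_iff_mem`: each reduction axiom is matched by a semantic equivalence (such as
`satOn_ann_assign`), and what it leads to has smaller `complexity`. Satisfaction and membership are
therefore reduced in parallel.

The domain is constant and consists of classes of variables, so all worlds share their witnesses,
and no fresh variable can be added when a successor is built. A world must therefore already name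
the values that terms take in the situations it considers possible: if it contains `l.app χ`, it
contains some `l.app (χ ∧ t ≈ y)`. Fresh variables make this consistent (`neg_app_of_fresh`), and
the property passes to successors by prefixing `⟨K_i⟩` to `l` (`isPossibility_dia`). Both the
initial world and the successors come from one generic construction, `exists_saturated`, which meets
countably many dense requirements and so needs a countable language.

An arbitrary formula lies in a countable sublanguage with infinitely many variables. Validity
descends to it because models expand (`EpistemicValid.of_map`), and derivations map back
(`SPALAS5.map`). -/

namespace PALAS

open Formula Term

/-! ### Derived rules, and witnesses under nested possibilities. -/

section Calculus

variable {V N I P : Type u} {ar : P → ℕ}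

/-- `v` assigns truth values to all formulas and respects negation and conjunction. -/
structure IsValuation (v : Formula V N I ar → Prop) : Prop where
  neg : ∀ α, v (neg α) ↔ ¬ v α
  and : ∀ α β, v (and α β) ↔ (v α ∧ v β)

namespace IsValuation

variable {v : Formula V N I ar → Prop}

theorem imp (h : IsValuation v) (φ ψ : Formula V N I ar) : v (imp φ ψ) ↔ (v φ → v ψ) := by
  simp [Formula.imp, h.neg, h.and]

theorem iff (h : IsValuation v) (φ ψ : Formula V N I ar) : v (iff φ ψ) ↔ (v φ ↔ v ψ) := by
  simp only [Formula.iff, h.and, h.imp]; tauto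

theorem verum (h : IsValuation v) (χ : Formula V N I ar) : v (verum χ) := (h.imp _ _).2 fun a => a

theorem conj (h : IsValuation v) (χ : Formula V N I ar) {l : List (Formula V N I ar)} (hl : ∀ φ ∈ l, v φ) :
    v (conj χ l) := by
  induction l with
  | nil => exact h.verum χ
  | cons φ l ih =>
    exact (h.and _ _).2 ⟨hl _ (by simp), ih fun ψ hψ => hl _ (by simp [hψ])⟩

end IsValuation

/-- The dual `⟨K_i⟩ φ` of the knowledge operator. -/
def Formula.dia (i : I) (φ : Formula V N I ar) : Formula V N I ar := neg (know i (neg φ))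

variable [DecidableEq V]

namespace SPALAS5

variable {φ ψ χ α β : Formula V N I ar}

theorem of_valuation (h : ∀ v, IsValuation v → v φ) : SPALAS5 φ :=
  .sbelas (.taut _ fun v hn ha => h v ⟨hn, ha⟩)

theorem of_valuation₁ (h₁ : SPALAS5 α) (h : ∀ v, IsValuation v → v α → v φ) : SPALAS5 φ :=
  .mp h₁ (of_valuation fun v hv => (hv.imp _ _).2 (h v hv))

theorem of_valuation₂ (h₁ : SPALAS5 α) (h₂ : SPALAS5 β)
    (h : ∀ v, IsValuation v → v α → v β → v φ) : SPALAS5 φ :=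
  .mp h₂ (of_valuation₁ h₁ fun v hv a => (hv.imp _ _).2 (h v hv a))

theorem of_valuation₃ (h₁ : SPALAS5 α) (h₂ : SPALAS5 β) (h₃ : SPALAS5 χ)
    (h : ∀ v, IsValuation v → v α → v β → v χ → v φ) : SPALAS5 φ :=
  .mp h₃ (of_valuation₂ h₁ h₂ fun v hv a b => (hv.imp _ _).2 (h v hv a b))

theorem imp_trans (h₁ : SPALAS5 (imp φ ψ)) (h₂ : SPALAS5 (imp ψ χ)) : SPALAS5 (imp φ χ) :=
  of_valuation₂ h₁ h₂ fun v hv a b => by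
    rw [hv.imp] at *; exact fun c => b (a c)

theorem know_mono (i : I) (h : SPALAS5 (imp φ ψ)) : SPALAS5 (imp (know i φ) (know i ψ)) :=
  .mp (.necK i h) (.sbelas (.distK i φ ψ))

theorem dia_mono (i : I) (h : SPALAS5 (imp φ ψ)) : SPALAS5 (imp (dia i φ) (dia i ψ)) :=
  of_valuation₁ (know_mono i (of_valuation₁ h (φ := imp (neg ψ) (neg φ)) fun v hv a => by
    simp only [hv.imp, hv.neg] at *; tauto)) fun v hv a => by
    simp only [dia, hv.imp, hv.neg] at *; tauto

/-- In S5, `⟨K_i⟩` is left adjoint to `K_i`, since T and 5 give `α → K_i ⟨K_i⟩ α`. This lets a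
modality be moved from one side of an implication to the other. -/
theorem dia_imp_iff (i : I) : SPALAS5 (imp (dia i α) β) ↔ SPALAS5 (imp α (know i β)) := by
  constructor
  · intro h
    refine of_valuation₃ (know_mono i h) (.s5 (.five i (neg α))) (.s5 (.t i (neg α)))
      fun v hv a b c => ?_
    simp only [dia, hv.imp, hv.neg] at *; tauto
  · intro h
    have h₁ : SPALAS5 (imp (neg (know i β)) (neg α)) := of_valuation₁ h fun v hv a => by
      simp only [hv.imp, hv.neg] at *; tauto
    refine of_valuation₃ (know_mono i h₁) (.s5 (.five i β)) (.s5 (.t i β))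
      fun v hv a b c => ?_
    simp only [dia, hv.imp, hv.neg] at *; tauto

theorem assign_of [Nontrivial V] (x : V) (t : Term V N) (h : SPALAS5 φ) :
    SPALAS5 (assign x t φ) := by
  -- The rule for assignments needs an antecedent without free `x`; `y ≈ y` is a derivable one.
  obtain ⟨y, hy⟩ := exists_ne x
  have hx : x ∉ (eq (var y) (var y) : Formula V N I ar).fv := by
    simp [fv, Term.vars, hy.symm]
  exact .mp (.sbelas (.id (var y))) (.necAs x t hx (of_valuation₁ h fun v hv a => by
    rw [hv.imp]; exact fun _ => a))

theorem assign_mono [Nontrivial V] (x : V) (t : Term V N) (h : SPALAS5 (imp φ ψ)) :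
    SPALAS5 (imp (assign x t φ) (assign x t ψ)) :=
  .mp (assign_of x t h) (.sbelas (.kAs x t φ ψ))

/-- `[x := t]` is functional: seriality (`dAs`) gives one direction, determinism (`detAs`) the
other. -/
theorem assign_neg [Nontrivial V] (x : V) (t : Term V N) (φ : Formula V N I ar) :
    SPALAS5 (iff (assign x t (neg φ)) (neg (assign x t φ))) := by
  have h : SPALAS5 (imp φ (imp (neg φ) (neg (verum φ)))) := of_valuation fun v hv => by
    simp only [hv.imp, hv.neg]; tauto
  refine of_valuation₃ (.mp (assign_mono x t h)
    (of_valuation₁ (.sbelas (.kAs x t (neg φ) (neg (verum φ))))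
      (φ := imp _ (imp (assign x t φ) (imp (assign x t (neg φ)) (assign x t (neg (verum φ))))))
      fun v hv a => ?_)) (.sbelas (.dAs x t φ)) (.sbelas (.detAs x t φ)) fun v hv a b c => ?_
  · simp only [hv.imp] at *; tauto
  · simp only [dassign, hv.imp, hv.neg, hv.iff] at *; tauto

/-- The converse of `sub2As` is its instance for `¬φ`, contraposed by `assign_neg`. -/
theorem assign_var (x y : V) [Nontrivial V] (hφ : Admissible y x φ) :
    SPALAS5 (iff (subst y x φ) (assign x (var y) φ)) :=
  of_valuation₃ (.sbelas (.sub2As x y φ hφ))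
    (.sbelas (.sub2As x y (neg φ) (by simpa [Admissible] using hφ)))
    (assign_neg x (var y) φ) fun v hv a b c => by
      simp only [Formula.subst, hv.imp, hv.neg, hv.iff] at *; tauto

end SPALAS5

/-- A possibility form: a context built up from conjunctions with given formulas and from
the operators `⟨K_i⟩`. -/
abbrev PossForm (V N I : Type u) {P : Type u} (ar : P → ℕ) : Type u :=
  List (Formula V N I ar ⊕ I)

/-- The result of filling the hole of a possibility form with a formula. -/
def PossForm.app : PossForm V N I ar → Formula V N I ar → Formula V N I ar
  | [], χ => χ
  | .inl φ :: l, χ => and φ (app l χ)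
  | .inr i :: l, χ => dia i (app l χ)

/-- The context `l` is absorbed into `θ` layer by layer: conjuncts by currying, `⟨K_i⟩` by the
adjunction `dia_imp_iff`. At the hole, `θ ∧ χ → y ≉ t` yields `θ ∧ χ → [y := t] y ≉ t` by freshness,
against the axiom `[y := t] y ≈ t`. -/
theorem SPALAS5.neg_app_of_fresh [Nontrivial V] {t : Term V N} {y : V}
    {χ : Formula V N I ar} (l : PossForm V N I ar) (hl : y ∉ (l.app χ).fv)
    (θ : Formula V N I ar) (hθ : y ∉ θ.fv)
    (h : SPALAS5 (imp θ (neg (l.app (and χ (eq t (var y))))))) :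
    SPALAS5 (imp θ (neg (l.app χ))) := by
  induction l generalizing θ with
  | nil =>
    have h₁ : SPALAS5 (imp (and θ χ) (neg (eq (var y) t))) :=
      of_valuation₂ h (.sbelas (.sym t (var y))) fun v hv a b => by
        simp only [PossForm.app, hv.imp, hv.neg, hv.iff, hv.and] at *; tauto
    have hf : y ∉ (and θ χ).fv := by
      simp only [fv, Finset.mem_union, not_or]; exact ⟨hθ, hl⟩
    refine of_valuation₃ (.necAs y t hf h₁) (assign_neg y t (eq (var y) t))
      (.sbelas (.efAs y t)) fun v hv a b c => ?_
    simp only [PossForm.app, hv.imp, hv.neg, hv.iff, hv.and] at *; tauto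
  | cons s l ih =>
    cases s with
    | inl φ =>
      simp only [PossForm.app, fv, Finset.mem_union, not_or] at hl
      refine of_valuation₁ (ih hl.2 (and θ φ) (by simp [fv, hθ, hl.1])
        (of_valuation₁ h fun v hv a => ?_)) fun v hv a => ?_ <;>
      · simp only [PossForm.app, hv.imp, hv.neg, hv.and] at *; tauto
    | inr i =>
      have h₁ : SPALAS5 (imp θ (know i (neg (PossForm.app l (and χ (eq t (var y))))))) :=
        of_valuation₁ h fun v hv a => by
          simp only [PossForm.app, dia, hv.imp, hv.neg] at *; tauto
      have h₂ := (dia_imp_iff i).1 (ih hl (dia i θ) (by simpa [dia, fv] using hθ)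
        ((dia_imp_iff i).2 h₁))
      exact of_valuation₁ h₂ fun v hv a => by
        simp only [PossForm.app, dia, hv.imp, hv.neg] at *; tauto

end Calculus

/-! ### Announcement semantics inside a fixed model; soundness of the reductions. -/

section RelativizedSemantics

variable {V N I P : Type u} {ar : P → ℕ}

/-- The model with set of worlds `W'` pulled back along `f : W' → M.W`. -/
abbrev Model.pull (M : Model N I ar) {W' : Type u} (hW : Nonempty W') (f : W' → M.W) :
    Model N I ar where
  W := W'
  D := M.D
  nonempty_W := hW
  nonempty_D := M.nonempty_D
  R i v v' := M.R i (f v) (f v')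
  ρ p v := M.ρ p (f v)
  η a v := M.η a (f v)

theorem Term.eval_pull (M : Model N I ar) {W' : Type u} (hW : Nonempty W') (f : W' → M.W)
    (t : Term V N) (w : W') (σ : V → M.D) :
    t.eval (M.pull hW f) w σ = t.eval M (f w) σ := by
  cases t <;> rfl

theorem Term.eval_congr {M : Model N I ar} {w : M.W} {σ τ : V → M.D} {t : Term V N} (h : ∀ x ∈ t.vars, σ x = τ x) :
    t.eval M w σ = t.eval M w τ := by
  cases t with
  | var x => exact h x (by simp [vars])
  | name a => rfl

variable [DecidableEq V]

/-- Satisfaction in the submodel of `M` given by the set of worlds `S`, expressed in `M`. -/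
def SatOn (M : Model N I ar) : Formula V N I ar → Set M.W → M.W → (V → M.D) → Prop
  | .eq t t', _, w, σ => t.eval M w σ = t'.eval M w σ
  | .pred p ts, _, w, σ => (fun k => (ts k).eval M w σ) ∈ M.ρ p w
  | .and φ ψ, S, w, σ => SatOn M φ S w σ ∧ SatOn M ψ S w σ
  | .neg φ, S, w, σ => ¬ SatOn M φ S w σ
  | .know i φ, S, w, σ => ∀ v ∈ S, M.R i w v → SatOn M φ S v σ
  | .assign x t φ, S, w, σ => SatOn M φ S w (Function.update σ x (t.eval M w σ))
  | .ann ψ φ, S, w, σ => SatOn M ψ S w σ → SatOn M φ {v ∈ S | SatOn M ψ S v σ} w σ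

/-- Iterated restriction produces subtypes of subtypes. Pullbacks along arbitrary maps absorb this:
a restriction of a pullback is again a pullback, along the composite, so the induction hypothesis
applies. -/
theorem sat_pull (M : Model N I ar) (φ : Formula V N I ar) :
    ∀ {W' : Type u} (hW : Nonempty W') (f : W' → M.W) (w : W') (σ : V → M.D),
      Sat φ (M.pull hW f) w σ ↔ SatOn M φ (Set.range f) (f w) σ := by
  induction φ with
  | eq t t' => intro W' hW f w σ; simp [Sat, SatOn, eval_pull]
  | pred p ts => intro W' hW f w σ; simp [Sat, SatOn, eval_pull]
  | and φ ψ ih₁ ih₂ => intro W' hW f w σ; simp only [Sat, SatOn, ih₁, ih₂]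
  | neg φ ih => intro W' hW f w σ; simp only [Sat, SatOn, ih]
  | know i φ ih =>
    intro W' hW f w σ
    simp only [Sat, SatOn, ih, Set.forall_mem_range]
  | assign x t φ ih => intro W' hW f w σ; simp only [Sat, SatOn, ih, eval_pull]
  | ann ψ φ ih₁ ih₂ =>
    intro W' hW f w σ
    have hr : ∀ h : Sat ψ (M.pull hW f) w σ,
        Sat φ ((M.pull hW f).restrict {v | Sat ψ (M.pull hW f) v σ} ⟨w, h⟩) ⟨w, h⟩ σ ↔
          SatOn M φ {v ∈ Set.range f | SatOn M ψ (Set.range f) v σ} (f w) σ := by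
      intro h
      have hS : {v ∈ Set.range f | SatOn M ψ (Set.range f) v σ} =
          Set.range fun v : {v | Sat ψ (M.pull hW f) v σ} => f v.1 := by
        ext u
        constructor
        · rintro ⟨⟨v, rfl⟩, hv⟩
          exact ⟨⟨v, (ih₁ hW f v σ).2 hv⟩, rfl⟩
        · rintro ⟨v, rfl⟩
          exact ⟨⟨v.1, rfl⟩, (ih₁ hW f v.1 σ).1 v.2⟩
      rw [hS]
      exact ih₂ ⟨⟨w, h⟩⟩ (fun v : {v | Sat ψ (M.pull hW f) v σ} => f v.1) ⟨w, h⟩ σ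
    constructor
    · intro h hw
      have hw' := (ih₁ hW f w σ).2 hw
      exact (hr hw').1 (h hw')
    · intro h hw
      exact (hr hw).2 (h ((ih₁ hW f w σ).1 hw))

theorem sat_iff_satOn (M : Model N I ar) (φ : Formula V N I ar) (w : M.W) (σ : V → M.D) :
    Sat φ M w σ ↔ SatOn M φ Set.univ w σ := by
  have := sat_pull M φ M.nonempty_W id w σ
  rwa [Set.range_id] at this

variable {M : Model N I ar} {S : Set M.W} {w : M.W} {σ τ : V → M.D}

@[simp] theorem satOn_and {φ ψ : Formula V N I ar} :
    SatOn M (and φ ψ) S w σ ↔ SatOn M φ S w σ ∧ SatOn M ψ S w σ := Iff.rfl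

@[simp] theorem satOn_neg {φ : Formula V N I ar} :
    SatOn M (neg φ) S w σ ↔ ¬ SatOn M φ S w σ := Iff.rfl

theorem satOn_congr (φ : Formula V N I ar) : ∀ {S : Set M.W} {w : M.W} {σ τ : V → M.D},
    (∀ x ∈ φ.vars, σ x = τ x) → (SatOn M φ S w σ ↔ SatOn M φ S w τ) := by
  induction φ with
  | eq t t' =>
    intro S w σ τ h
    simp only [Formula.vars, Finset.mem_union] at h
    simp only [SatOn, eval_congr (fun x hx => h x (.inl hx)), eval_congr (fun x hx => h x (.inr hx))]
  | pred p ts =>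
    intro S w σ τ h
    have : ∀ k, (ts k).eval M w σ = (ts k).eval M w τ := fun k =>
      eval_congr fun x hx => h x (by simpa [Formula.vars] using ⟨k, hx⟩)
    simp only [SatOn, this]
  | and φ ψ ih₁ ih₂ =>
    intro S w σ τ h
    simp only [Formula.vars, Finset.mem_union] at h
    simp only [SatOn, ih₁ (fun x hx => h x (.inl hx)), ih₂ (fun x hx => h x (.inr hx))]
  | neg φ ih => intro S w σ τ h; simp only [SatOn, ih h]
  | know i φ ih => intro S w σ τ h; simp only [SatOn, ih h]
  | assign x t φ ih =>
    intro S w σ τ h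
    simp only [Formula.vars, Finset.mem_union, Finset.mem_insert] at h
    simp only [SatOn, eval_congr (fun x hx => h x (.inr (.inl hx)))]
    refine ih fun z hz => ?_
    by_cases hzx : z = x
    · simp [hzx]
    · simpa [hzx] using h z (.inr (.inr hz))
  | ann ψ φ ih₁ ih₂ =>
    intro S w σ τ h
    simp only [Formula.vars, Finset.mem_union] at h
    simp only [SatOn, ih₁ (fun x hx => h x (.inl hx)), ih₂ (fun x hx => h x (.inr hx))]

theorem Term.eval_subst (y x : V) (t : Term V N) :
    (t.subst y x).eval M w σ = t.eval M w (Function.update σ x (σ y)) := by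
  cases t with
  | var z => by_cases h : z = x <;> simp [Term.subst, h, eval]
  | name a => rfl

theorem satOn_subst {y x : V} (φ : Formula V N I ar) :
    ∀ {S : Set M.W} {w : M.W} {σ : V → M.D}, y ∉ φ.vars →
      (SatOn M (φ.subst y x) S w σ ↔ SatOn M φ S w (Function.update σ x (σ y))) := by
  induction φ with
  | eq t t' => intro S w σ h; simp only [Formula.subst, SatOn, eval_subst]
  | pred p ts => intro S w σ h; simp only [Formula.subst, SatOn, eval_subst]
  | and φ ψ ih₁ ih₂ =>
    intro S w σ h
    simp only [Formula.vars, Finset.mem_union, not_or] at h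
    simp only [Formula.subst, SatOn, ih₁ h.1, ih₂ h.2]
  | neg φ ih => intro S w σ h; simp only [Formula.subst, SatOn, ih h]
  | know i φ ih => intro S w σ h; simp only [Formula.subst, SatOn, ih h]
  | assign z t φ ih =>
    intro S w σ h
    simp only [Formula.vars, Finset.mem_union, Finset.mem_insert, not_or] at h
    simp only [Formula.subst, SatOn, eval_subst]
    by_cases hz : z = x
    · subst hz; simp
    · rw [if_neg hz, ih h.2.2, Function.update_of_ne h.1, Function.update_comm hz]
  | ann ψ φ ih₁ ih₂ =>
    intro S w σ h
    simp only [Formula.vars, Finset.mem_union, not_or] at h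
    simp only [Formula.subst, SatOn, ih₁ h.1, ih₂ h.2]

theorem admissible_of_notMem_vars {y x : V} {φ : Formula V N I ar} (h : y ∉ φ.vars) :
    Admissible y x φ := by
  induction φ with
  | eq | pred => trivial
  | and φ ψ ih₁ ih₂ | ann φ ψ ih₁ ih₂ =>
    simp only [Formula.vars, Finset.mem_union, not_or] at h
    exact ⟨ih₁ h.1, ih₂ h.2⟩
  | neg φ ih | know i φ ih => exact ih h
  | assign z t φ ih =>
    simp only [Formula.vars, Finset.mem_union, Finset.mem_insert, not_or] at h
    exact .inr ⟨ih h.2.2, fun hz => absurd hz.symm h.1⟩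

theorem satOn_ann_neg {ψ φ : Formula V N I ar} :
    SatOn M (ann ψ (neg φ)) S w σ ↔ (SatOn M ψ S w σ → ¬ SatOn M (ann ψ φ) S w σ) := by
  simp only [SatOn]; tauto

theorem satOn_ann_and {ψ φ χ : Formula V N I ar} :
    SatOn M (ann ψ (and φ χ)) S w σ ↔ (SatOn M (ann ψ φ) S w σ ∧ SatOn M (ann ψ χ) S w σ) := by
  simp only [SatOn]; tauto

theorem satOn_ann_know {i : I} {ψ φ : Formula V N I ar} :
    SatOn M (ann ψ (know i φ)) S w σ ↔
      (SatOn M ψ S w σ → SatOn M (know i (ann ψ φ)) S w σ) := by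
  simp only [SatOn, Set.mem_ofPred_eq, and_imp]
  exact ⟨fun h a v b c d => h a v b d c, fun h a v b c d => h a v b d c⟩

theorem satOn_ann_ann {ψ χ φ : Formula V N I ar} :
    SatOn M (ann ψ (ann χ φ)) S w σ ↔ SatOn M (ann (and ψ (ann ψ χ)) φ) S w σ := by
  have : {v ∈ {v ∈ S | SatOn M ψ S v σ} | SatOn M χ {v ∈ S | SatOn M ψ S v σ} v σ} =
      {v ∈ S | SatOn M ψ S v σ ∧ (SatOn M ψ S v σ → SatOn M χ {v ∈ S | SatOn M ψ S v σ} v σ)} := by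
    ext v; simp only [Set.mem_ofPred_eq]; tauto
  simp only [SatOn, this]; tauto

/-- The variable `z` keeps the old value of `x`, so after `x` is reassigned `ψ[z/x]` still defines
the same set of worlds as `ψ` did before. -/
theorem satOn_ann_assign {ψ φ : Formula V N I ar} {x z : V} {t : Term V N}
    (hz : z ∉ (ann ψ (assign x t φ)).vars) :
    SatOn M (ann ψ (assign x t φ)) S w σ ↔
      SatOn M (assign z (var x) (assign x t (ann (subst z x ψ) φ))) S w σ := by
  simp only [Formula.vars, Finset.mem_union, Finset.mem_insert, not_or] at hz
  obtain ⟨hψ, hzx, ht, hφ⟩ := hz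
  have upd : ∀ (ρ : V → M.D) (d : M.D) (θ : Formula V N I ar), z ∉ θ.vars →
      ∀ y ∈ θ.vars, Function.update ρ z d y = ρ y := fun ρ d θ hθ y hy =>
    Function.update_of_ne (fun h => hθ (h.subst (motive := (· ∈ _)) hy)) ..
  have e : t.eval M w (Function.update σ z (σ x)) = t.eval M w σ :=
    eval_congr fun y hy => Function.update_of_ne (fun h => ht (h.subst (motive := (· ∈ _)) hy)) ..
  have hs : ∀ {v : M.W} {d : M.D},
      SatOn M (ψ.subst z x) S v (Function.update (Function.update σ z (σ x)) x d) ↔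
        SatOn M ψ S v σ := by
    intro v d
    rw [satOn_subst ψ hψ, Function.update_idem, Function.update_of_ne hzx, Function.update_self,
      Function.update_comm hzx, Function.update_eq_self]
    exact satOn_congr ψ (upd _ _ ψ hψ)
  have hx : (Term.var x : Term V N).eval M w σ = σ x := rfl
  simp only [SatOn, hx, e, hs]
  rw [Function.update_comm hzx, satOn_congr φ (upd _ _ φ hφ)]

end RelativizedSemantics

/-! ### Countability of the language. -/

section Countability

variable {V N I P : Type u} {ar : P → ℕ}

instance Term.instCountable [Countable V] [Countable N] : Countable (Term V N) := by
  refine Function.Injective.countable (β := V ⊕ N)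
    (f := fun t => match t with | .var x => .inl x | .name a => .inr a) ?_
  rintro (x | a) (y | b) h <;> simp_all

/-- The symbols of the prefix notation of formulas: atomic formulas, unary operators (`none` is
negation) and binary ones (`true` is conjunction). -/
abbrev Formula.Symbol (V N I : Type u) {P : Type u} (ar : P → ℕ) : Type u :=
  (Term V N × Term V N ⊕ Σ p, Fin (ar p) → Term V N) ⊕ (Option (I ⊕ V × Term V N) ⊕ Bool)

/-- The prefix notation of a formula. -/
def Formula.toList : Formula V N I ar → List (Formula.Symbol V N I ar)
  | .eq t t' => [.inl (.inl (t, t'))]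
  | .pred p ts => [.inl (.inr ⟨p, ts⟩)]
  | .neg φ => .inr (.inl none) :: φ.toList
  | .know i φ => .inr (.inl (some (.inl i))) :: φ.toList
  | .assign x t φ => .inr (.inl (some (.inr (x, t)))) :: φ.toList
  | .and φ ψ => .inr (.inr true) :: (φ.toList ++ ψ.toList)
  | .ann φ ψ => .inr (.inr false) :: (φ.toList ++ ψ.toList)

/-- Unique readability of prefix notation. The remainders `l` and `m` are carried along because, at
a binary operator, the code of the second argument is the remainder of the first. -/
theorem Formula.toList_append_inj (φ : Formula V N I ar) :
    ∀ (ψ : Formula V N I ar) (l m : List (Formula.Symbol V N I ar)),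
      φ.toList ++ l = ψ.toList ++ m → φ = ψ ∧ l = m := by
  induction φ with
  | eq t t' | pred p ts =>
    intro ψ l m h
    cases ψ <;> simp_all [toList]
  | neg φ ih | know i φ ih | assign x t φ ih =>
    intro ψ l m h
    cases ψ <;> simp [toList] at h ⊢
    simpa [h] using ih _ _ _ (by simp [h])
  | and φ φ' ih ih' | ann φ φ' ih ih' =>
    intro ψ l m h
    cases ψ <;> simp [toList] at h ⊢
    obtain ⟨h₁, h₂⟩ := ih _ _ _ h
    obtain ⟨h₃, h₄⟩ := ih' _ _ _ h₂
    exact ⟨⟨h₁, h₃⟩, h₄⟩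

instance Formula.instCountable [Countable V] [Countable N] [Countable I] [Countable P] :
    Countable (Formula V N I ar) :=
  Function.Injective.countable (f := toList) fun φ ψ h =>
    (toList_append_inj φ ψ [] [] (by rw [h])).1

end Countability

/-! ### Saturated sets by a generic construction. -/

section Saturation
variable {V N I P : Type u} {ar : P → ℕ} [DecidableEq V]

/-- A maximal consistent set of formulas in which every term that is used in some possible
situation has a witness among the variables, which can be chosen outside a given finite set. -/
structure Saturated (Γ : Set (Formula V N I ar)) : Prop where
  mem_of_derivable : ∀ {φ}, SPALAS5 φ → φ ∈ Γ
  isValuation : IsValuation (· ∈ Γ)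
  -- Avoiding `s` allows a witness to be substituted without capture.
  witness : ∀ (l : PossForm V N I ar) (χ : Formula V N I ar) (t : Term V N) (s : Finset V),
    PossForm.app l χ ∈ Γ → ∃ y ∉ s, PossForm.app l (and χ (eq t (var y))) ∈ Γ

/-- A notion of possibility of formulas for which saturated sets of possible formulas can be
constructed. -/
structure IsPossibility (A : Formula V N I ar → Prop) : Prop where
  mono : ∀ {φ ψ}, SPALAS5 (imp φ ψ) → A φ → A ψ
  split : ∀ φ {δ}, A δ → A (and φ δ) ∨ A (and (neg φ) δ)
  consistent : ∀ {δ}, A δ → ¬ SPALAS5 (neg δ)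
  witness : ∀ (l : PossForm V N I ar) (χ : Formula V N I ar) (t : Term V N) (s : Finset V),
    A (PossForm.app l χ) → ∃ y ∉ s, A (PossForm.app l (and χ (eq t (var y))))

/-- Possible formulas, ordered by strength: the larger one derives the smaller one. -/
structure IsPossibility.Condition {A : Formula V N I ar → Prop} (hA : IsPossibility A) where
  formula : Formula V N I ar
  possible : A formula

instance IsPossibility.instPreorder {A : Formula V N I ar → Prop} (hA : IsPossibility A) :
    Preorder hA.Condition where
  le c d := SPALAS5 (imp d.formula c.formula)
  le_refl c := .of_valuation fun v hv => (hv.imp _ _).2 id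
  le_trans _ _ _ h h' := .imp_trans h' h

/-- A Rasiowa–Sikorski argument: an ideal of conditions meets each of the countably many cofinal
sets `D k`, where a condition either refutes `l.app χ` or supplies a witness for it. `Γ` collects
everything that the ideal derives. -/
theorem IsPossibility.exists_saturated [Infinite V] [Countable V] [Countable N] [Countable I]
    [Countable P] {A : Formula V N I ar → Prop} (hA : IsPossibility A) {δ : Formula V N I ar}
    (hδ : A δ) : ∃ Γ, Saturated Γ ∧ δ ∈ Γ ∧ ∀ φ ∈ Γ, A φ := by
  let ι := PossForm V N I ar × Formula V N I ar × Term V N × Finset V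
  have : Encodable ι := Encodable.ofCountable _
  let D : ι → Order.Cofinal hA.Condition := fun k =>
    { carrier := {c | SPALAS5 (imp c.formula (neg (PossForm.app k.1 k.2.1))) ∨
        ∃ y ∉ k.2.2.2, SPALAS5 (imp c.formula
          (PossForm.app k.1 (and k.2.1 (eq k.2.2.1 (var y)))))}
      isCofinal := by
        rintro ⟨θ, hθ⟩
        rcases hA.split (PossForm.app k.1 k.2.1) hθ with h | h
        -- Putting `θ` into the context makes the witnessed formula a strengthening of the given
        -- condition.
        · obtain ⟨y, hy, h'⟩ := hA.witness (.inl θ :: k.1) k.2.1 k.2.2.1 k.2.2.2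
            (hA.mono (.of_valuation fun v hv => by
              simp only [PossForm.app, hv.imp, hv.and]; tauto) h)
          exact ⟨⟨_, h'⟩, .inr ⟨y, hy, .of_valuation fun v hv => by
            simp only [PossForm.app, hv.imp, hv.and]; tauto⟩, .of_valuation fun v hv => by
            simp only [PossForm.app, hv.imp, hv.and]; tauto⟩
        · exact ⟨⟨_, h⟩, .inl (.of_valuation fun v hv => by
            simp only [hv.imp, hv.and]; tauto), .of_valuation fun v hv => by
            simp only [hv.imp, hv.and]; tauto⟩ }
  let J := Order.idealOfCofinals (⟨δ, hδ⟩ : hA.Condition) D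
  have hJ : ∀ k, ∃ c ∈ J, c ∈ D k := fun k =>
    let ⟨c, h, h'⟩ := Order.cofinal_meets_idealOfCofinals (⟨δ, hδ⟩ : hA.Condition) D k
    ⟨c, h', h⟩
  let Γ : Set (Formula V N I ar) := {φ | ∃ c ∈ J, SPALAS5 (imp c.formula φ)}
  have hc : ∀ {φ ψ χ : Formula V N I ar}, φ ∈ Γ → ψ ∈ Γ →
      (∀ v : Formula V N I ar → Prop, IsValuation v → v φ → v ψ → v χ) →
      ∃ c ∈ J, SPALAS5 (imp c.formula χ) := by
    rintro φ ψ χ ⟨c, hcJ, hc⟩ ⟨d, hdJ, hd⟩ h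
    obtain ⟨e, heJ, hce, hde⟩ := J.directed c hcJ d hdJ
    refine ⟨e, heJ, .of_valuation₂ (.imp_trans hce hc) (.imp_trans hde hd) fun v hv a b => ?_⟩
    rw [hv.imp] at *
    exact fun he => h v hv (a he) (b he)
  have hcons : ∀ {φ}, φ ∈ Γ → neg φ ∉ Γ := by
    intro φ h h'
    obtain ⟨c, -, hc⟩ := hc (χ := neg (verum φ)) h h' fun v hv a b => absurd a ((hv.neg _).1 b)
    exact hA.consistent c.possible (.of_valuation₁ hc fun v hv a => by
      have := hv.verum φ
      simp only [hv.imp, hv.neg] at *; tauto)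
  obtain ⟨x⟩ : Nonempty V := inferInstance
  refine ⟨Γ, ⟨?_, ⟨fun φ => ⟨fun h h' => hcons h' h, fun h => ?_⟩, fun φ ψ => ⟨fun h => ⟨?_, ?_⟩,
    fun h => hc h.1 h.2 fun v hv a b => (hv.and _ _).2 ⟨a, b⟩⟩⟩, ?_⟩, ?_, ?_⟩
  · exact fun h => ⟨_, Order.mem_idealOfCofinals _ D, .of_valuation₁ h fun v hv a => by
      rw [hv.imp]; exact fun _ => a⟩
  -- With the empty form, the requirement decides `φ`; this is maximality.
  · obtain ⟨c, hcJ, hc | ⟨y, -, hc⟩⟩ := hJ ([], φ, var x, ∅)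
    · exact ⟨c, hcJ, hc⟩
    · exact absurd ⟨c, hcJ, .of_valuation₁ hc fun v hv a => by
        simp only [PossForm.app, hv.imp, hv.and] at *; tauto⟩ h
  · exact hc h h fun v hv a _ => ((hv.and _ _).1 a).1
  · exact hc h h fun v hv a _ => ((hv.and _ _).1 a).2
  · intro l χ t s h
    obtain ⟨c, hcJ, hc | ⟨y, hy, hc⟩⟩ := hJ (l, χ, t, s)
    · exact absurd ⟨c, hcJ, hc⟩ (hcons h)
    · exact ⟨y, hy, c, hcJ, hc⟩
  · exact ⟨_, Order.mem_idealOfCofinals _ D, .of_valuation fun v hv => (hv.imp _ _).2 id⟩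
  · exact fun φ ⟨c, _, hc⟩ => hA.mono hc c.possible

theorem isPossibility_consistent [Infinite V] :
    IsPossibility fun φ : Formula V N I ar => ¬ SPALAS5 (neg φ) where
  mono h h' h'' := h' (.of_valuation₂ h h'' fun v hv a b => by
    simp only [hv.imp, hv.neg] at *; tauto)
  split φ δ h := by
    by_contra! h'
    exact h (.of_valuation₂ h'.1 h'.2 fun v hv a b => by
      simp only [hv.and, hv.neg] at *; tauto)
  consistent h := h
  witness l χ t s h := by
    -- For `y` outside these free variables, refuting the witnessed form would refute the form
    -- itself.
    obtain ⟨y, hy⟩ := Infinite.exists_notMem_finset (s ∪ (PossForm.app l χ).fv)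
    obtain ⟨z, hz⟩ := exists_ne y
    simp only [Finset.mem_union, not_or] at hy
    refine ⟨y, hy.1, fun h' => h ?_⟩
    have := SPALAS5.neg_app_of_fresh l hy.2 (eq (var z) (var z))
      (by simp [fv, Term.vars, hz.symm]) (.of_valuation₁ h' fun v hv a => by
        rw [hv.imp]; exact fun _ => a)
    exact .mp (.sbelas (.id _)) this

namespace Saturated

variable {Γ : Set (Formula V N I ar)} {φ ψ : Formula V N I ar}

theorem mem_neg (hΓ : Saturated Γ) : neg φ ∈ Γ ↔ φ ∉ Γ := hΓ.isValuation.neg φ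
theorem mem_and (hΓ : Saturated Γ) : and φ ψ ∈ Γ ↔ φ ∈ Γ ∧ ψ ∈ Γ := hΓ.isValuation.and φ ψ
theorem mem_imp (hΓ : Saturated Γ) : imp φ ψ ∈ Γ ↔ (φ ∈ Γ → ψ ∈ Γ) := hΓ.isValuation.imp φ ψ
theorem mem_iff (hΓ : Saturated Γ) : iff φ ψ ∈ Γ ↔ (φ ∈ Γ ↔ ψ ∈ Γ) := hΓ.isValuation.iff φ ψ
theorem mem_dia (hΓ : Saturated Γ) {i : I} : dia i φ ∈ Γ ↔ know i (neg φ) ∉ Γ := hΓ.mem_neg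

theorem mono (hΓ : Saturated Γ) (h : SPALAS5 (imp φ ψ)) (hφ : φ ∈ Γ) : ψ ∈ Γ :=
  hΓ.mem_imp.1 (hΓ.mem_of_derivable h) hφ

theorem congr (hΓ : Saturated Γ) (h : SPALAS5 (iff φ ψ)) : φ ∈ Γ ↔ ψ ∈ Γ :=
  hΓ.mem_iff.1 (hΓ.mem_of_derivable h)

/-- What `Γ` holds possible for `i` inherits its witnesses from `Γ`, with no fresh variable needed.
-/
theorem isPossibility_dia (hΓ : Saturated Γ) (i : I) :
    IsPossibility fun φ => dia i φ ∈ Γ where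
  mono h := hΓ.mono (SPALAS5.dia_mono i h)
  split φ δ h := by
    simp only [hΓ.mem_dia] at *
    by_contra! h'
    refine h (hΓ.mem_imp.1 (hΓ.mono (.sbelas (.distK i _ _))
      (hΓ.mono (SPALAS5.know_mono i (.of_valuation fun v hv => ?_)) h'.1)) h'.2)
    simp only [hv.imp, hv.and, hv.neg]; tauto
  consistent h h' := hΓ.mem_dia.1 h (hΓ.mem_of_derivable (.necK i h'))
  witness l := hΓ.witness (.inr i :: l)

/-- Every member of `Δ` is possible according to `Γ`; axioms 4 and 5 then force agreement on all
formulas `K_i ψ`. -/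
theorem exists_successor [Infinite V] [Countable V] [Countable N] [Countable I] [Countable P]
    (hΓ : Saturated Γ) {i : I} (h : dia i φ ∈ Γ) :
    ∃ Δ, Saturated Δ ∧ φ ∈ Δ ∧ ∀ ψ, know i ψ ∈ Γ ↔ know i ψ ∈ Δ := by
  obtain ⟨Δ, hΔ, hφ, h⟩ := (hΓ.isPossibility_dia i).exists_saturated h
  refine ⟨Δ, hΔ, hφ, fun ψ => ⟨fun hψ => ?_, fun hψ => ?_⟩⟩
  · by_contra hn
    refine hΓ.mem_dia.1 (h _ (hΔ.mem_neg.2 hn)) (hΓ.mono (SPALAS5.know_mono i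
      (.of_valuation fun v hv => ?_)) (hΓ.mono (.s5 (.four i ψ)) hψ))
    simp only [hv.imp, hv.neg]; tauto
  · by_contra hn
    exact hΓ.mem_dia.1 (h _ hψ) (hΓ.mono (.s5 (.five i ψ)) (hΓ.mem_neg.2 hn))

theorem eq_symm (hΓ : Saturated Γ) {t t' : Term V N} : eq t t' ∈ Γ → eq t' t ∈ Γ :=
  (hΓ.congr (.sbelas (.sym t t'))).1

theorem eq_trans (hΓ : Saturated Γ) {t t' t'' : Term V N} (h : eq t t' ∈ Γ)
    (h' : eq t' t'' ∈ Γ) : eq t t'' ∈ Γ :=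
  hΓ.mono (.sbelas (.trans t t' t'')) (hΓ.mem_and.2 ⟨h, h'⟩)

theorem exists_eq_var (hΓ : Saturated Γ) (t : Term V N) (s : Finset V) :
    ∃ y ∉ s, eq t (var y) ∈ Γ := by
  obtain ⟨y, hy, h⟩ := hΓ.witness [] (eq t t) t s (hΓ.mem_of_derivable (.sbelas (.id t)))
  exact ⟨y, hy, (hΓ.mem_and.1 h).2⟩

theorem pred_congr (hΓ : Saturated Γ) (p : P) {ts ts' : Fin (ar p) → Term V N}
    (h : ∀ k, eq (ts k) (ts' k) ∈ Γ) : pred p ts ∈ Γ ↔ pred p ts' ∈ Γ :=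
  hΓ.mem_iff.1 (hΓ.mono (.sbelas (.subP p ts ts')) (hΓ.isValuation.conj _ (by
    simpa [List.mem_ofFn] using h)))

end Saturated

end Saturation

/-! ### The canonical model and the truth lemma. -/

section CanonicalModel
variable {V N I P : Type u} {ar : P → ℕ}

/-- A measure of formulas that decreases when a reduction axiom is applied. -/
def Formula.complexity : Formula V N I ar → ℕ
  | eq _ _ => 1
  | pred _ _ => 1
  | and φ ψ => 1 + φ.complexity + ψ.complexity
  | neg φ => 1 + φ.complexity
  | know _ φ => 1 + φ.complexity
  | assign _ _ φ => 1 + φ.complexity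
  -- Moving `[!ψ]` past an operator saves at least `5 + ψ`, more than the two assignments created by
  -- `aAssi` cost. For `aCom`, the new factor `6 + ψ + (5 + ψ)χ` stays below `(5 + ψ)(5 + χ)`.
  | ann ψ φ => (5 + ψ.complexity) * φ.complexity

theorem Formula.complexity_pos (φ : Formula V N I ar) : 0 < φ.complexity := by
  induction φ <;> simp_all [complexity]

variable [DecidableEq V]

theorem Formula.complexity_subst (y x : V) (φ : Formula V N I ar) :
    (subst y x φ).complexity = φ.complexity := by
  induction φ with
  | assign z t φ ih => by_cases h : z = x <;> simp_all [complexity, Formula.subst]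
  | _ => simp_all [complexity, Formula.subst]

variable {Γ₀ : Set (Formula V N I ar)}

/-- Two variables are identified if `Γ` contains their equality. -/
def Saturated.setoid (h : Saturated Γ₀) : Setoid V where
  r x y := eq (var x) (var y) ∈ Γ₀
  iseqv := ⟨fun x => h.mem_of_derivable (.sbelas (.id (var x))), h.eq_symm, h.eq_trans⟩

/-- The canonical model: its worlds are the saturated sets that contain the same equalities
between variables as `Γ₀`. -/
noncomputable def Saturated.model [Nonempty V] (h : Saturated Γ₀) : Model N I ar where
  -- Agreement on equalities gives all worlds the same quotient of `V` as domain.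
  W := {Γ : Set (Formula V N I ar) //
    Saturated Γ ∧ ∀ x y, eq (var x) (var y) ∈ Γ ↔ eq (var x) (var y) ∈ Γ₀}
  D := Quotient h.setoid
  nonempty_W := ⟨⟨Γ₀, h, fun _ _ => Iff.rfl⟩⟩
  nonempty_D := ‹Nonempty V›.map (Quotient.mk h.setoid)
  R i Γ Δ := ∀ ψ, know i ψ ∈ Γ.1 ↔ know i ψ ∈ Δ.1
  ρ p Γ := {d | ∃ ys : Fin (ar p) → V, d = (fun k => Quotient.mk h.setoid (ys k)) ∧
    pred p (fun k => var (ys k)) ∈ Γ.1}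
  η a Γ := Quotient.mk h.setoid (Γ.2.1.exists_eq_var (name a) ∅).choose

theorem Saturated.model_isEpistemic [Nonempty V] (h : Saturated Γ₀) : h.model.IsEpistemic :=
  fun _ => ⟨fun _ _ => Iff.rfl, fun h ψ => (h ψ).symm, fun h h' ψ => (h ψ).trans (h' ψ)⟩

/-- The canonical assignment. -/
def Saturated.assignment [Nonempty V] (h : Saturated Γ₀) (x : V) : h.model.D :=
  Quotient.mk h.setoid x

theorem Saturated.assignment_eq_iff [Nonempty V] (h : Saturated Γ₀) (Γ : h.model.W) {x y : V} :
    h.assignment x = h.assignment y ↔ eq (var x) (var y) ∈ Γ.1 :=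
  (Quotient.eq (r := h.setoid)).trans (Γ.2.2 x y).symm

theorem Saturated.eval_eq_iff [Nonempty V] (h : Saturated Γ₀) (Γ : h.model.W) {t : Term V N}
    {y : V} : t.eval h.model Γ h.assignment = h.assignment y ↔ eq t (var y) ∈ Γ.1 := by
  cases t with
  | var x => exact h.assignment_eq_iff Γ
  | name a =>
    have hs := (Γ.2.1.exists_eq_var (name a) ∅).choose_spec.2
    refine (h.assignment_eq_iff Γ).trans ⟨fun h' => Γ.2.1.eq_trans hs h', fun h' => ?_⟩
    exact Γ.2.1.eq_trans (Γ.2.1.eq_symm hs) h'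

theorem Saturated.satOn_iff_mem [Infinite V] [Countable V] [Countable N] [Countable I]
    [Countable P] (h : Saturated Γ₀) (n : ℕ) : ∀ (φ : Formula V N I ar) (Γ : h.model.W),
      φ.complexity = n → (SatOn h.model φ Set.univ Γ h.assignment ↔ φ ∈ Γ.1) := by
  induction n using Nat.strong_induction_on with
  | _ n ih =>
  intro φ Γ hn
  have hΓ := Γ.2.1
  replace ih : ∀ (ψ : Formula V N I ar), ψ.complexity < φ.complexity → ∀ Γ : h.model.W,
      (SatOn h.model ψ Set.univ Γ h.assignment ↔ ψ ∈ Γ.1) := fun ψ hψ Γ => ih _ (hn ▸ hψ) ψ Γ rfl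
  clear hn
  cases φ with
  | eq t t' =>
    obtain ⟨y, -, hy⟩ := hΓ.exists_eq_var t' ∅
    simp only [SatOn, (h.eval_eq_iff Γ).2 hy]
    exact (h.eval_eq_iff Γ).trans ⟨fun h' => hΓ.eq_trans h' (hΓ.eq_symm hy),
      fun h' => hΓ.eq_trans h' hy⟩
  | pred p ts =>
    constructor
    · rintro ⟨ys, hys, hp⟩
      exact (hΓ.pred_congr p fun k => (h.eval_eq_iff Γ).1 (congrFun hys k)).2 hp
    · intro hp
      choose ys _ hys using fun k => hΓ.exists_eq_var (ts k) ∅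
      exact ⟨ys, funext fun k => (h.eval_eq_iff Γ).2 (hys k), (hΓ.pred_congr p hys).1 hp⟩
  | and φ ψ =>
    rw [hΓ.mem_and, satOn_and, ih φ (by simp only [complexity]; omega),
      ih ψ (by simp only [complexity]; omega)]
  | neg φ => rw [hΓ.mem_neg, satOn_neg, ih φ (by simp [complexity])]
  | know i φ =>
    have ihφ := ih φ (by simp [complexity])
    simp only [SatOn, ihφ, Set.mem_univ, true_implies]
    constructor
    · intro hφ
      by_contra hn
      obtain ⟨Δ, hΔ, hφΔ, hR⟩ := hΓ.exists_successor (i := i) (φ := neg φ) (hΓ.mem_dia.2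
        fun hk => hn (hΓ.mono (SPALAS5.know_mono i (.of_valuation fun v hv => by
          simp only [hv.imp, hv.neg]; tauto)) hk))
      -- The rigidity axioms keep the successor inside the model.
      have hD : ∀ x y, eq (var x) (var y) ∈ Δ ↔ eq (var x) (var y) ∈ Γ.1 := by
        refine fun x y => ⟨fun hx => ?_, fun hx => ?_⟩
        · by_contra hn
          exact hΔ.mem_neg.1 (hΔ.mono (.s5 (.t i _)) ((hR _).1
            (hΓ.mono (.sbelas (.rigidN i x y)) (hΓ.mem_neg.2 hn)))) hx
        · exact hΔ.mono (.s5 (.t i _)) ((hR _).1 (hΓ.mono (.sbelas (.rigidP i x y)) hx))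
      exact hΔ.mem_neg.1 hφΔ (hφ ⟨Δ, hΔ, fun x y => (hD x y).trans (Γ.2.2 x y)⟩ hR)
    · exact fun hk Δ hR => Δ.2.1.mono (.s5 (.t i φ)) ((hR φ).1 hk)
  | assign x t φ =>
    -- With `t ≈ y` in `Γ`, the assignment becomes the substitution `φ[y/x]`, which is simpler and
    -- is evaluated under the canonical assignment again.
    obtain ⟨y, hy, hty⟩ := hΓ.exists_eq_var t φ.vars
    rw [hΓ.mem_iff.1 (hΓ.mono (.sbelas (.subAs t (var y) x φ)) hty),
      ← hΓ.congr (SPALAS5.assign_var x y (admissible_of_notMem_vars hy)),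
      ← ih _ (by simp [complexity, complexity_subst]), satOn_subst φ hy]
    simp only [SatOn, (h.eval_eq_iff Γ).2 hty]
  | ann ψ φ =>
    have hψ : ψ.complexity < (ann ψ φ).complexity := by
      have := φ.complexity_pos
      simp only [complexity]; nlinarith
    cases φ with
    | eq t t' =>
      rw [hΓ.congr (.announcement (.aAtom ψ _ (.eq t t'))), hΓ.mem_imp, ← ih _ hψ,
        ← ih (eq t t') (by simp only [complexity]; omega)]
      rfl
    | pred p ts =>
      rw [hΓ.congr (.announcement (.aAtom ψ _ (.pred p ts))), hΓ.mem_imp, ← ih _ hψ,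
        ← ih (pred p ts) (by simp only [complexity]; omega)]
      rfl
    | and φ χ =>
      rw [hΓ.congr (.announcement (.aCon ψ φ χ)), hΓ.mem_and, satOn_ann_and,
        ih (ann ψ φ) (by simp only [complexity]; nlinarith),
        ih (ann ψ χ) (by simp only [complexity]; nlinarith)]
    | neg φ =>
      rw [hΓ.congr (.announcement (.aNeg ψ φ)), hΓ.mem_imp, hΓ.mem_neg, satOn_ann_neg,
        ih _ hψ, ih (ann ψ φ) (by simp only [complexity]; nlinarith)]
    | know i φ =>
      rw [hΓ.congr (.announcement (.aK i ψ φ)), hΓ.mem_imp, satOn_ann_know,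
        ih _ hψ, ih (know i (ann ψ φ)) (by simp only [complexity]; nlinarith)]
    | assign x t φ =>
      obtain ⟨z, hz⟩ := Infinite.exists_notMem_finset (ann ψ (assign x t φ)).vars
      rw [hΓ.congr (.announcement (.aAssi ψ x t φ z hz)), satOn_ann_assign hz,
        ih _ (by simp only [complexity, complexity_subst]; nlinarith)]
    | ann χ φ =>
      have := φ.complexity_pos
      rw [hΓ.congr (.announcement (.aCom ψ χ φ)), satOn_ann_ann,
        ih _ (by
          simp only [complexity]
          rw [← mul_assoc]
          exact Nat.mul_lt_mul_of_pos_right (by nlinarith) this)]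

theorem SPALAS5.of_epistemicValid_of_countable [Infinite V] [Countable V] [Countable N]
    [Countable I] [Countable P] {φ : Formula V N I ar} (hφ : EpistemicValid φ) : SPALAS5 φ := by
  by_contra hn
  obtain ⟨Γ, hΓ, hmem, -⟩ := isPossibility_consistent.exists_saturated (δ := neg φ) fun h =>
    hn (.of_valuation₁ h fun v hv a => by simpa [hv.neg] using a)
  refine hΓ.mem_neg.1 hmem ((hΓ.satOn_iff_mem _ φ ⟨Γ, hΓ, fun _ _ => Iff.rfl⟩ rfl).1 ?_)
  exact (sat_iff_satOn _ _ _ _).1 (hφ _ hΓ.model_isEpistemic _ _)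

end CanonicalModel

/-! ### Transfer of validity and derivability along embeddings of languages. -/

section LanguageEmbedding
variable {V N I P V' N' I' P' : Type u} {ar : P → ℕ}
  (fV : V' ↪ V) (fN : N' ↪ N) (fI : I' ↪ I) (fP : P' ↪ P)

/-- The image of a term under a renaming of variables and names. -/
def Term.map : Term V' N' → Term V N
  | .var x => .var (fV x)
  | .name a => .name (fN a)

/-- The image of a formula under a renaming of all symbols. -/
def Formula.map : Formula V' N' I' (fun p => ar (fP p)) → Formula V N I ar
  | eq t t' => eq (t.map fV fN) (t'.map fV fN)
  | pred p ts => pred (fP p) fun k => (ts k).map fV fN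
  | and φ ψ => and (map φ) (map ψ)
  | neg φ => neg (map φ)
  | know i φ => know (fI i) (map φ)
  | assign x t φ => assign (fV x) (t.map fV fN) (map φ)
  | ann ψ φ => ann (map ψ) (map φ)

/-- An expansion of a model to a larger language. -/
noncomputable def Model.expand (M : Model N' I' (fun p => ar (fP p))) : Model N I ar where
  W := M.W
  D := M.D
  nonempty_W := M.nonempty_W
  nonempty_D := M.nonempty_D
  -- For an agent outside the range this is the total relation, so the expansion stays epistemic.
  R i w v := ∀ j, fI j = i → M.R j w v
  ρ p w := {d | ∃ (p' : P') (h : fP p' = p),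
    (fun k => d (Fin.cast (congrArg ar h) k)) ∈ M.ρ p' w}
  η a w := Function.extend fN (fun b => M.η b w) (fun _ => Classical.choice M.nonempty_D) a

variable {fV fN fI fP}

theorem Model.IsEpistemic.expand {M : Model N' I' (fun p => ar (fP p))} (hM : M.IsEpistemic) :
    (M.expand fN fI fP).IsEpistemic := fun _ =>
  ⟨fun w j _ => (hM j).refl w, fun h j hj => (hM j).symm (h j hj),
    fun h h' j hj => (hM j).trans (h j hj) (h' j hj)⟩

theorem Term.eval_map {M : Model N' I' (fun p => ar (fP p))} {w : M.W} {σ : V → M.D}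
    (t : Term V' N') :
    (t.map fV fN).eval (M.expand fN fI fP) w σ = t.eval M w (fun x => σ (fV x)) := by
  cases t with
  | var x => rfl
  | name a =>
    exact fN.injective.extend_apply (fun b => M.η b w) (fun _ => Classical.choice M.nonempty_D) a

theorem Term.mem_vars_map {t : Term V' N'} {x : V'} :
    fV x ∈ (t.map fV fN).vars ↔ x ∈ t.vars := by
  cases t <;> simp [Term.map, vars]

theorem Formula.map_conj (χ : Formula V' N' I' (fun p => ar (fP p))) (l : List (Formula _ _ _ _)) :
    (conj χ l).map fV fN fI fP =
      conj (χ.map fV fN fI fP) (l.map fun φ => φ.map fV fN fI fP) := by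
  induction l with
  | nil => rfl
  | cons φ l ih => exact congrArg (Formula.and _) ih

variable [DecidableEq V] [DecidableEq V']

theorem satOn_map {M : Model N' I' (fun p => ar (fP p))}
    (φ : Formula V' N' I' (fun p => ar (fP p))) : ∀ {S : Set M.W} {w : M.W} {σ : V → M.D},
      SatOn (M.expand fN fI fP) (φ.map fV fN fI fP) S w σ ↔ SatOn M φ S w (fun x => σ (fV x)) := by
  induction φ with
  | eq t t' => intro S w σ; simp only [Formula.map, SatOn, eval_map]; rfl
  | pred p ts =>
    intro S w σ
    simp only [Formula.map, SatOn, eval_map]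
    constructor
    · rintro ⟨p', h, hp⟩
      obtain rfl := fP.injective h
      exact hp
    · exact fun hp => ⟨p, rfl, hp⟩
  | and φ ψ ih₁ ih₂ => intro S w σ; simp only [Formula.map, SatOn, ih₁, ih₂]
  | neg φ ih => intro S w σ; simp only [Formula.map, SatOn, ih]
  | know i φ ih =>
    intro S w σ
    have hR : ∀ v, (M.expand fN fI fP).R (fI i) w v ↔ M.R i w v := fun v =>
      ⟨fun h => h i rfl, fun h j hj => fI.injective hj ▸ h⟩
    simp only [Formula.map, SatOn]
    exact forall₂_congr fun v _ => imp_congr (hR v) ih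
  | assign x t φ ih =>
    intro S w σ
    simp only [Formula.map, SatOn, eval_map]
    refine ih.trans ?_
    exact iff_of_eq (congrArg _ (Function.update_comp_eq_of_injective σ fV.injective x _))
  | ann ψ φ ih₁ ih₂ =>
    intro S w σ
    simp only [Formula.map, SatOn]
    have hS : {v | v ∈ S ∧ SatOn (M.expand fN fI fP) (ψ.map fV fN fI fP) S v σ} =
      {v | v ∈ S ∧ SatOn M ψ S v fun x => σ (fV x)} := Set.ext fun v => and_congr_right' ih₁
    refine imp_congr ih₁ ?_
    rw [← hS]
    exact ih₂

theorem EpistemicValid.of_map {φ : Formula V' N' I' (fun p => ar (fP p))}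
    (h : EpistemicValid (φ.map fV fN fI fP)) : EpistemicValid φ := by
  intro M hM w σ
  let τ : V → M.D := Function.extend fV σ fun _ => Classical.choice M.nonempty_D
  have hτ : (fun x => τ (fV x)) = σ := funext fun x => fV.injective.extend_apply σ _ x
  rw [sat_iff_satOn, ← hτ]
  exact (satOn_map φ).1
    ((sat_iff_satOn (M.expand fN fI fP) (φ.map fV fN fI fP) w τ).1 (h _ hM.expand w τ))

theorem Formula.mem_vars_map {φ : Formula V' N' I' (fun p => ar (fP p))} {x : V'} :
    fV x ∈ (φ.map fV fN fI fP).vars ↔ x ∈ φ.vars := by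
  induction φ <;> simp_all [Formula.map, Formula.vars, Term.mem_vars_map]

theorem Formula.mem_fv_map {φ : Formula V' N' I' (fun p => ar (fP p))} {x : V'} :
    fV x ∈ (φ.map fV fN fI fP).fv ↔ x ∈ φ.fv := by
  induction φ <;> simp_all [Formula.map, fv, Term.mem_vars_map]

theorem Term.map_subst (y x : V') (t : Term V' N') :
    (t.subst y x).map fV fN = (t.map fV fN).subst (fV y) (fV x) := by
  cases t with
  | var z => by_cases h : z = x <;> simp [Term.map, Term.subst, h]
  | name a => rfl

theorem Formula.map_subst (y x : V') (φ : Formula V' N' I' (fun p => ar (fP p))) :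
    (φ.subst y x).map fV fN fI fP = (φ.map fV fN fI fP).subst (fV y) (fV x) := by
  induction φ with
  | assign z t φ ih =>
    by_cases h : z = x <;> simp_all [Formula.map, Formula.subst, Term.map_subst]
  | _ => simp_all [Formula.map, Formula.subst, Term.map_subst]

theorem Formula.Admissible.map {y x : V'} {φ : Formula V' N' I' (fun p => ar (fP p))}
    (h : Admissible y x φ) : Admissible (fV y) (fV x) (φ.map fV fN fI fP) := by
  induction φ <;> simp_all [Formula.map, Admissible, mem_fv_map]
  tauto

/-- Injectivity of the renamings preserves the side conditions on variables; valuations pull back,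
so tautologies map to tautologies. -/
theorem SPALAS5.map {φ : Formula V' N' I' (fun p => ar (fP p))} (h : SPALAS5 φ) :
    SPALAS5 (φ.map fV fN fI fP) := by
  induction h with
  | sbelas h =>
    cases h with
    | taut φ h => exact .sbelas (.taut _ fun v hn ha =>
        h (fun α => v (α.map fV fN fI fP)) (fun _ => hn _) fun _ _ => ha _ _)
    | distK => exact .sbelas (.distK _ _ _)
    | id => exact .sbelas (.id _)
    | sym => exact .sbelas (.sym _ _)
    | trans => exact .sbelas (.trans _ _ _)
    | subAs => exact .sbelas (.subAs _ _ _ _)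
    | subP p ts ts' =>
      have h : SPALAS5 _ := .sbelas (.subP (N := N) (I := I) (ar := ar) (fP p)
        (fun k => (ts k).map fV fN) fun k => (ts' k).map fV fN)
      simp only [Formula.imp, Formula.map, map_conj, List.map_ofFn] at h ⊢
      exact h
    | rigidP => exact .sbelas (.rigidP _ _ _)
    | rigidN => exact .sbelas (.rigidN _ _ _)
    | kAs => exact .sbelas (.kAs _ _ _ _)
    | detAs => exact .sbelas (.detAs _ _ _)
    | dAs => exact .sbelas (.dAs _ _ _)
    | efAs => exact .sbelas (.efAs _ _)
    | sub2As x y φ h =>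
      have := SPALAS5.sbelas (.sub2As _ _ _ (h.map (fV := fV) (fN := fN) (fI := fI) (fP := fP)))
      rw [← Formula.map_subst] at this
      exact this
  | s5 h =>
    cases h with
    | t => exact .s5 (.t _ _)
    | four => exact .s5 (.four _ _)
    | five => exact .s5 (.five _ _)
  | announcement h =>
    cases h with
    | aAtom ψ p hp =>
      refine .announcement (.aAtom _ _ ?_)
      cases hp with
      | eq => exact .eq _ _
      | pred => exact .pred _ _
    | aNeg => exact .announcement (.aNeg _ _)
    | aCon => exact .announcement (.aCon _ _ _)
    | aK => exact .announcement (.aK _ _ _)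
    | aCom => exact .announcement (.aCom _ _ _)
    | aAssi ψ x t φ z hz =>
      have := SPALAS5.announcement (.aAssi (ψ.map fV fN fI fP) (fV x) (t.map fV fN)
        (φ.map fV fN fI fP) (fV z) fun h => hz (mem_vars_map.1 h))
      rw [← Formula.map_subst] at this
      exact this
  | necK i _ ih => exact .necK _ ih
  | mp _ _ ih₁ ih₂ => exact .mp ih₁ ih₂
  | necAs x t hx _ ih => exact .necAs _ _ (fun h => hx (mem_fv_map.1 h)) ih

end LanguageEmbedding

/-! ### Reduction to a countable sublanguage. -/

section Sublanguage
variable {V N I P : Type u} {ar : P → ℕ}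

/-- The embedding of the variables in a set `Q` of symbols. -/
abbrev varEmb (Q : Set (V ⊕ N ⊕ I ⊕ P)) : {x : V // .inl x ∈ Q} ↪ V := .subtype _
/-- The embedding of the names in a set `Q` of symbols. -/
abbrev nameEmb (Q : Set (V ⊕ N ⊕ I ⊕ P)) : {a : N // .inr (.inl a) ∈ Q} ↪ N := .subtype _
/-- The embedding of the agents in a set `Q` of symbols. -/
abbrev agentEmb (Q : Set (V ⊕ N ⊕ I ⊕ P)) : {i : I // .inr (.inr (.inl i)) ∈ Q} ↪ I := .subtype _
/-- The embedding of the predicates in a set `Q` of symbols. -/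
abbrev predEmb (Q : Set (V ⊕ N ⊕ I ⊕ P)) : {p : P // .inr (.inr (.inr p)) ∈ Q} ↪ P := .subtype _

theorem Term.exists_map_eq (t : Term V N) : ∃ Q : Set (V ⊕ N ⊕ I ⊕ P), Q.Countable ∧
    ∀ Q', Q ⊆ Q' → ∃ t', Term.map (varEmb Q') (nameEmb Q') t' = t := by
  cases t with
  | var x =>
    exact ⟨{.inl x}, Set.countable_singleton _, fun Q' h => ⟨.var ⟨x, h rfl⟩, rfl⟩⟩
  | name a =>
    exact ⟨{.inr (.inl a)}, Set.countable_singleton _, fun Q' h => ⟨.name ⟨a, h rfl⟩, rfl⟩⟩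

/-- Allowing every `Q'` above `Q` lets the symbol sets of subformulas be joined in the induction. -/
theorem Formula.exists_map_eq (φ : Formula V N I ar) : ∃ Q : Set (V ⊕ N ⊕ I ⊕ P), Q.Countable ∧
    ∀ Q', Q ⊆ Q' →
      ∃ φ', Formula.map (varEmb Q') (nameEmb Q') (agentEmb Q') (predEmb Q') φ' = φ := by
  induction φ with
  | eq t t' =>
    obtain ⟨Q₁, hQ₁, h₁⟩ := t.exists_map_eq (I := I) (P := P)
    obtain ⟨Q₂, hQ₂, h₂⟩ := t'.exists_map_eq (I := I) (P := P)
    refine ⟨Q₁ ∪ Q₂, hQ₁.union hQ₂, fun Q' h => ?_⟩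
    obtain ⟨t₁, rfl⟩ := h₁ Q' (Set.subset_union_left.trans h)
    obtain ⟨t₂, rfl⟩ := h₂ Q' (Set.subset_union_right.trans h)
    exact ⟨.eq t₁ t₂, rfl⟩
  | pred p ts =>
    choose Q hQ h using fun k => (ts k).exists_map_eq (I := I) (P := P)
    refine ⟨insert (.inr (.inr (.inr p))) (⋃ k, Q k), (Set.countable_iUnion hQ).insert _,
      fun Q' h' => ?_⟩
    choose ts' hts using fun k => h k Q'
      ((Set.subset_iUnion Q k).trans ((Set.subset_insert _ _).trans h'))
    obtain rfl : _ = ts := funext hts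
    exact ⟨.pred ⟨p, h' (Set.mem_insert _ _)⟩ ts', rfl⟩
  | and φ ψ ih₁ ih₂ =>
    obtain ⟨Q₁, hQ₁, h₁⟩ := ih₁
    obtain ⟨Q₂, hQ₂, h₂⟩ := ih₂
    refine ⟨Q₁ ∪ Q₂, hQ₁.union hQ₂, fun Q' h => ?_⟩
    obtain ⟨φ₁, rfl⟩ := h₁ Q' (Set.subset_union_left.trans h)
    obtain ⟨φ₂, rfl⟩ := h₂ Q' (Set.subset_union_right.trans h)
    exact ⟨.and φ₁ φ₂, rfl⟩
  | neg φ ih =>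
    obtain ⟨Q, hQ, h⟩ := ih
    refine ⟨Q, hQ, fun Q' h' => ?_⟩
    obtain ⟨φ, rfl⟩ := h Q' h'
    exact ⟨.neg φ, rfl⟩
  | know i φ ih =>
    obtain ⟨Q, hQ, h⟩ := ih
    refine ⟨insert (.inr (.inr (.inl i))) Q, hQ.insert _, fun Q' h' => ?_⟩
    obtain ⟨φ, rfl⟩ := h Q' ((Set.subset_insert _ _).trans h')
    exact ⟨.know ⟨i, h' (Set.mem_insert _ _)⟩ φ, rfl⟩
  | assign x t φ ih =>
    obtain ⟨Q₁, hQ₁, h₁⟩ := t.exists_map_eq (I := I) (P := P)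
    obtain ⟨Q₂, hQ₂, h₂⟩ := ih
    refine ⟨insert (.inl x) (Q₁ ∪ Q₂), (hQ₁.union hQ₂).insert _, fun Q' h => ?_⟩
    have h' := (Set.subset_insert _ _).trans h
    obtain ⟨t, rfl⟩ := h₁ Q' (Set.subset_union_left.trans h')
    obtain ⟨φ, rfl⟩ := h₂ Q' (Set.subset_union_right.trans h')
    exact ⟨.assign ⟨x, h (Set.mem_insert _ _)⟩ t φ, rfl⟩
  | ann φ ψ ih₁ ih₂ =>
    obtain ⟨Q₁, hQ₁, h₁⟩ := ih₁
    obtain ⟨Q₂, hQ₂, h₂⟩ := ih₂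
    refine ⟨Q₁ ∪ Q₂, hQ₁.union hQ₂, fun Q' h => ?_⟩
    obtain ⟨φ₁, rfl⟩ := h₁ Q' (Set.subset_union_left.trans h)
    obtain ⟨φ₂, rfl⟩ := h₂ Q' (Set.subset_union_right.trans h)
    exact ⟨.ann φ₁ φ₂, rfl⟩

theorem SPALAS5.of_epistemicValid [DecidableEq V] [Infinite V] {φ : Formula V N I ar}
    (hφ : EpistemicValid φ) : SPALAS5 φ := by
  obtain ⟨Q₀, hQ₀, h⟩ := φ.exists_map_eq
  let g : ℕ ↪ V := Infinite.natEmbedding V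
  -- The extra variables keep the sublanguage infinite in variables, as fresh witnesses require.
  let Q : Set (V ⊕ N ⊕ I ⊕ P) := Q₀ ∪ Set.range fun n => .inl (g n)
  have : Countable Q := (hQ₀.union (Set.countable_range _)).to_subtype
  obtain ⟨φ', rfl⟩ := h Q Set.subset_union_left
  have hc : ∀ {α : Type u} (f : α → V ⊕ N ⊕ I ⊕ P), f.Injective → Countable {a // f a ∈ Q} :=
    fun f hf => Function.Injective.countable (f := fun a => (⟨f a.1, a.2⟩ : Q)) fun a b hab =>
      Subtype.ext (hf (congrArg Subtype.val hab))
  have := hc Sum.inl Sum.inl_injective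
  have := hc (fun a => .inr (.inl a)) fun a b hab => by simpa using hab
  have := hc (fun i => .inr (.inr (.inl i))) fun a b hab => by simpa using hab
  have := hc (fun p => .inr (.inr (.inr p))) fun a b hab => by simpa using hab
  have : Infinite {x : V // .inl x ∈ Q} :=
    Infinite.of_injective (fun n => ⟨g n, .inr ⟨n, rfl⟩⟩) fun m n hmn =>
      g.injective (congrArg Subtype.val hmn)
  exact (SPALAS5.of_epistemicValid_of_countable hφ.of_map).map

end Sublanguage
end PALAS

theorem mainTheorem4 {V N I P : Type u} [DecidableEq V] [Infinite V] (ar : P → ℕ)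
    (φ : PALAS.Formula V N I ar) (hφ : PALAS.EpistemicValid φ) :
    PALAS.SPALAS5 φ :=
  .of_epistemicValid hφ
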